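/- Let $M$ be a compact metric space on which a compact Hausdorff topological group $G$ acts continuously by isometries, and suppose that $M$ is two-point homogeneous: whenever $d(x,y)=d(x',y')$ there is $g\in G$ with $gx=x'$ and $gy=y'$. Let $\mu$ be the $G$-invariant probability measure on $M$, i.e. the image of the normalized Haar measure of $G$ under $g\mapsto gx_0$ for a point $x_0\in M$. Let $\tau(x,y)=\varphi(d(x,y))$ be a distance function on $M$, where $\varphi$ is a real function that is injective on the set of distances occurring in $M$, and let $\tau_0=\tau(x,x)$. A real function $p$ is called a zonal spherical function of $M$ if there is a finite-dimensional subspace $V\subset L^2(M,\mu)$ (complex-valued functions) that is an irreducible representation of $G$ under the translations $f\mapsto f(g^{-1}\,\cdot\,)$ and has an orthonormal basis $e_1,\dots,e_h$ (taken as continuous functions) with $p(\tau(x,y))=\sum_{i=1}^h e_i(x)\overline{e_i(y)}$ for all $x,y\in M$. Theorem. Let $s\ge 2$, let $X\subset M$ be an $s$-distance set, i.e. a finite set with exactly $s$ distinct distances between distinct points, and let $\tau$ take only the values $\beta_1,\dots,\beta_s$ on pairs of distinct points of $X$. Let $V_{s-1}$ be the linear space of real functions on $M$ spanned by all functions $x\mapsto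 Q(\tau(x,\xi))$, where $\xi\in M$ and $Q$ is a real polynomial of degree at most $s-1$; suppose that it is finite-dimensional and let $K=\dim V_{s-1}$. Put $$k_l=-\prod_{i\ne l}\frac{\tau_0-\beta_i}{\beta_l-\beta_i}\qquad(1\le l\le s).$$ Assume $|X|>1+K(s-1)$, and let $P$ be any non-negative linear combination of zonal spherical functions of $M$ (finite, or countably infinite and converging pointwise on the set of values of $\tau$). Then $$0\le\bigl(|X|-1-K(s-1)\bigr)\Bigl(P(\tau_0)+\sum_{l=1}^s k_l\,P(\beta_l)\Bigr)\le |X|\,P(\tau_0).$$ -/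

import Mathlib

open MeasureTheory

noncomputable section

/-- `G` acts on the metric space `M` by isometries, continuously, and transitively on ordered pairs
of points with the same distance. -/
structure IsTwoPointHomogeneous (G M : Type*) [Group G] [TopologicalSpace G] [MetricSpace M]
    [MulAction G M] : Prop where
  continuous_smul : Continuous fun p : G × M => p.1 • p.2
  dist_smul : ∀ (g : G) (x y : M), dist (g • x) (g • y) = dist x y
  exists_smul_eq : ∀ x y x' y' : M, dist x y = dist x' y' → ∃ g : G, g • x = x' ∧ g • y = y'

/-- A (modified) distance function on `M`: a real function of two points that carries the same
information as the metric, that is, an injective function of the distance. (On the unit sphere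
the scalar product is one.) -/
def IsDistanceFunction {M : Type*} [MetricSpace M] (τ : M → M → ℝ) : Prop :=
  ∀ x y x' y' : M, τ x y = τ x' y' ↔ dist x y = dist x' y'

/-- The invariant probability measure on the orbit `M = G • x₀`: the image of the normalized Haar
measure of the compact group `G` under `g ↦ g • x₀`. -/
def invariantMeasure (G : Type*) {M : Type*} [Group G] [TopologicalSpace G] [IsTopologicalGroup G]
    [CompactSpace G] [MeasurableSpace G] [BorelSpace G] [MeasurableSpace M] [MulAction G M]
    (x₀ : M) : Measure M :=
  (Measure.haarMeasure (⊤ : TopologicalSpace.PositiveCompacts G)).map fun g => g • x₀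

section Representation

variable (G : Type*) {M : Type*} [Group G] [MeasurableSpace M] [MulAction G M] {μ : Measure M}

/-- The subspace `V` of `L²(M, μ)` is invariant under all translations `f ↦ f (g⁻¹ • ·)`. -/
def IsTranslationInvariant (V : Submodule ℂ (Lp ℂ 2 μ)) : Prop :=
  ∀ (g : G) (f f' : Lp ℂ 2 μ), f ∈ V → (f' =ᵐ[μ] fun x => f (g⁻¹ • x)) → f' ∈ V

/-- The subspace `V` of `L²(M, μ)` is an irreducible (unitary) representation of `G` under
translations. -/
structure IsIrreducibleSubrepresentation (V : Submodule ℂ (Lp ℂ 2 μ)) : Prop where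
  ne_bot : V ≠ ⊥
  invariant : IsTranslationInvariant G V
  eq_bot_or_eq : ∀ W : Submodule ℂ (Lp ℂ 2 μ), W ≤ V → IsTranslationInvariant G W → W = ⊥ ∨ W = V

end Representation

section Zonal

variable (G : Type*) {M : Type*} [Group G] [TopologicalSpace G] [IsTopologicalGroup G]
  [CompactSpace G] [MeasurableSpace G] [BorelSpace G] [MetricSpace M] [MeasurableSpace M]
  [MulAction G M]

/-- The real function `p` of one variable is a zonal spherical function with respect to the distance
function `τ`: there is an irreducible subrepresentation `V` of `L²(M)` with an orthonormal basis
`e₁, …, eₕ` such that `p (τ x y) = ∑ i, eᵢ(x) * conj (eᵢ(y))` for all points `x`, `y`.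
Elements of `L²(M)` are classes of functions; the values of `eᵢ` at points are those of
its continuous representative `E i`. -/
def IsZonalSphericalFunction (x₀ : M) (τ : M → M → ℝ) (p : ℝ → ℝ) : Prop :=
  ∃ (V : Submodule ℂ (Lp ℂ 2 (invariantMeasure G x₀))) (h : ℕ)
    (e : OrthonormalBasis (Fin h) ℂ V) (E : Fin h → C(M, ℂ)),
    IsIrreducibleSubrepresentation G V ∧
    (∀ i, ⇑(E i) =ᵐ[invariantMeasure G x₀] ⇑(e i : Lp ℂ 2 (invariantMeasure G x₀))) ∧
    ∀ x y : M, (p (τ x y) : ℂ) = ∑ i, E i x * starRingEnd ℂ (E i y)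

/-- `P` is a non-negative linear combination `∑ k, a k * Z k` of zonal spherical functions
(a finite one, where almost all `a k` vanish, or an infinite one that converges pointwise), as a
function on the set of values of the distance function. -/
def IsNonnegZonalCombination (x₀ : M) (τ : M → M → ℝ) (P : ℝ → ℝ) : Prop :=
  ∃ (a : ℕ → ℝ) (Z : ℕ → ℝ → ℝ), (∀ k, 0 ≤ a k) ∧
    (∀ k, IsZonalSphericalFunction G x₀ τ (Z k)) ∧
    ∀ x y : M, HasSum (fun k => a k * Z k (τ x y)) (P (τ x y))

end Zonal

/-- A finite set of points with exactly `s` distinct distances between distinct points. -/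
def IsSDistanceSet {M : Type*} [MetricSpace M] (s : ℕ) (X : Finset M) : Prop :=
  {d : ℝ | ∃ x ∈ X, ∃ y ∈ X, x ≠ y ∧ d = dist x y}.ncard = s

/-- The space of real functions on `M` spanned by all `x ↦ Q (τ x ξ)` with `ξ` a point of `M` and
`Q` a real polynomial of degree at most `d`. -/
def zonalPolynomialSpace {M : Type*} (τ : M → M → ℝ) (d : ℕ) : Submodule ℝ (M → ℝ) :=
  Submodule.span ℝ {f | ∃ (Q : Polynomial ℝ) (ξ : M), Q.natDegree ≤ d ∧ f = fun x => Q.eval (τ x ξ)}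

/-- The weight `k_l = - ∏_{i ≠ l} (τ₀ - β_i) / (β_l - β_i)`. -/
def lagrangeWeight {s : ℕ} (τ₀ : ℝ) (β : Fin s → ℝ) (l : Fin s) : ℝ :=
  -∏ i ∈ Finset.univ.erase l, (τ₀ - β i) / (β l - β i)

end

/-! The matrix A = (P(τ(x,y))) indexed by X is positive semidefinite, since zonal functions are Gram
kernels, and has trace |X| P(τ₀). Let F_l be the Lagrange basis at the nodes β. Off the diagonal P
equals its interpolant ∑ P(β_l) F_l, so A = ∑ P(β_l) F_l(τ) + c·I, where c is the interpolation
error at τ₀. The F_l have degree s - 1 and sum to 1, so all matrices F_l(τ) vanish on a subspace W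
of codimension at most 1 + K(s - 1). There A acts as c: positivity on a nonzero vector of W gives c
≥ 0, and comparing traces gives c · dim W ≤ |X| P(τ₀). -/

open Finset in
/-- If a linear map with non-negative quadratic form acts on a subspace as the scalar `c`, its
trace is at least `c` times the dimension of the subspace. -/
theorem mul_finrank_le_trace {E : Type*} [NormedAddCommGroup E] [InnerProductSpace ℝ E]
    [FiniteDimensional ℝ E] (A : E →ₗ[ℝ] E) (hA : ∀ v, 0 ≤ inner ℝ v (A v))
    (W : Submodule ℝ E) (c : ℝ) (hW : ∀ w ∈ W, A w = c • w) :
    c * Module.finrank ℝ W ≤ LinearMap.trace ℝ E A := by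
  classical
  set b := stdOrthonormalBasis ℝ W
  have hb : Orthonormal ℝ fun i => (b i : E) :=
    b.orthonormal.comp_linearIsometry W.subtypeₗᵢ
  -- The trace is computed in an orthonormal basis extending one of W; the added vectors contribute
  -- non-negative terms.
  obtain ⟨u, b', hu, hb'⟩ := hb.toSubtypeRange.exists_orthonormalBasis_extension
  have hinj : Function.Injective fun i => (b i : E) := hb.linearIndependent.injective
  have himage : univ.image (fun i => (b i : E)) ⊆ u := by
    intro v hv
    obtain ⟨i, -, rfl⟩ := mem_image.1 hv
    exact hu ⟨i, rfl⟩
  have htrace : LinearMap.trace ℝ E A = ∑ v ∈ u, inner ℝ v (A v) := by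
    rw [LinearMap.trace_eq_sum_inner A b', ← sum_coe_sort u]
    simp [hb']
  rw [htrace]
  calc c * Module.finrank ℝ W = ∑ v ∈ univ.image (fun i => (b i : E)), inner ℝ v (A v) := by
        rw [sum_image fun i _ j _ h => hinj h]
        have h (i) : inner ℝ (b i : E) (A (b i)) = c := by
          rw [hW _ (b i).2, inner_smul_right, real_inner_self_eq_norm_sq, hb.1 i]
          simp
        simp [h, mul_comm]
    _ ≤ _ := sum_le_sum_of_subset_of_nonneg himage fun v _ _ => hA v

/-- This identifies P(τ₀) + ∑ k_l P(β_l) as the error at τ₀ of interpolating P at the nodes β. -/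
theorem lagrangeWeight_eq_neg_eval {s : ℕ} (τ₀ : ℝ) (β : Fin s → ℝ) (l : Fin s) :
    lagrangeWeight τ₀ β l = -(Lagrange.basis Finset.univ β l).eval τ₀ := by
  simp only [lagrangeWeight, Lagrange.basis, Lagrange.basisDivisor, Polynomial.eval_prod,
    Polynomial.eval_mul, Polynomial.eval_C, Polynomial.eval_sub, Polynomial.eval_X]
  congr 1
  exact Finset.prod_congr rfl fun i _ => by rw [div_eq_inv_mul]

section Positivity

variable {G M : Type*} [Group G] [TopologicalSpace G] [IsTopologicalGroup G]
  [CompactSpace G] [MeasurableSpace G] [BorelSpace G] [MetricSpace M] [MeasurableSpace M]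
  [MulAction G M] {x₀ : M} {τ : M → M → ℝ}

/-- The quadratic form equals ∑ᵢ |∑ₓ v(x) eᵢ(x)|². -/
theorem IsZonalSphericalFunction.sum_nonneg {p : ℝ → ℝ}
    (hp : IsZonalSphericalFunction G x₀ τ p) (X : Finset M) (v : X → ℝ) :
    0 ≤ ∑ x, ∑ y, v x * v y * p (τ x y) := by
  obtain ⟨V, h, e, E, -, -, hE⟩ := hp
  have key : ((∑ x, ∑ y, v x * v y * p (τ x y) : ℝ) : ℂ) =
      ((∑ i, Complex.normSq (∑ x : X, v x * E i x) : ℝ) : ℂ) := by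
    push_cast
    simp only [Complex.normSq_eq_conj_mul_self, map_sum, map_mul, Complex.conj_ofReal, hE,
      Finset.mul_sum, Finset.sum_mul]
    simp_rw [Finset.sum_comm (s := (Finset.univ : Finset X)) (t := (Finset.univ : Finset (Fin h)))]
    refine Finset.sum_congr rfl fun i _ => ?_
    refine Finset.sum_congr rfl fun x _ => Finset.sum_congr rfl fun y _ => ?_
    ring
  rw [Complex.ofReal_inj.1 key]
  exact Finset.sum_nonneg fun i _ => Complex.normSq_nonneg _

theorem IsNonnegZonalCombination.sum_nonneg {P : ℝ → ℝ}
    (hP : IsNonnegZonalCombination G x₀ τ P) (X : Finset M) (v : X → ℝ) :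
    0 ≤ ∑ x, ∑ y, v x * v y * P (τ x y) := by
  obtain ⟨a, Z, ha, hZ, hsum⟩ := hP
  have h : HasSum (fun k => ∑ x : X, ∑ y : X, v x * v y * (a k * Z k (τ x y)))
      (∑ x : X, ∑ y : X, v x * v y * P (τ x y)) :=
    hasSum_sum fun x _ => hasSum_sum fun y _ => (hsum x y).mul_left _
  refine h.nonneg fun k => ?_
  have := mul_nonneg (ha k) ((hZ k).sum_nonneg X v)
  simp only [Finset.mul_sum] at this
  refine this.trans_eq (Finset.sum_congr rfl fun x _ => Finset.sum_congr rfl fun y _ => ?_)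
  ring

end Positivity

section Distances

variable {M : Type*} {τ : M → M → ℝ} {s : ℕ} {X : Finset M} {β : Fin s → ℝ}

/-- The `s` values of a distance function on an `s`-distance set are distinct. -/
theorem IsSDistanceSet.injective [MetricSpace M] (hX : IsSDistanceSet s X) (hτ : IsDistanceFunction τ)
    (hβ : ∀ x ∈ X, ∀ y ∈ X, x ≠ y → ∃ l, τ x y = β l) : Function.Injective β := by
  classical
  set D : Set ℝ := {d : ℝ | ∃ x ∈ X, ∃ y ∈ X, x ≠ y ∧ d = dist x y}
  have hτD : ∀ d : D, ∃ l, ∃ x ∈ X, ∃ y ∈ X, d.1 = dist x y ∧ τ x y = β l := by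
    rintro ⟨d, x, hx, y, hy, hxy, rfl⟩
    obtain ⟨l, hl⟩ := hβ x hx y hy hxy
    exact ⟨l, x, hx, y, hy, rfl, hl⟩
  choose f hf using hτD
  -- The map `f` from distances to indices is injective between sets of size s, hence bijective, so
  -- injectivity passes from `β ∘ f` to `β`.
  have hinj : Function.Injective (β ∘ f) := by
    intro d d' h
    obtain ⟨x, -, y, -, hd, hl⟩ := hf d
    obtain ⟨x', -, y', -, hd', hl'⟩ := hf d'
    apply Subtype.ext
    rw [hd, hd', ← hτ, hl, hl']
    exact h
  have hfin : Finite D := Finite.of_injective _ hinj.of_comp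
  have hcard : Nat.card D = Nat.card (Fin s) := by
    rw [Nat.card_fin]; exact hX
  have hbij : Function.Bijective f :=
    (Nat.bijective_iff_injective_and_card f).2 ⟨hinj.of_comp, hcard⟩
  exact (Function.Injective.of_comp_iff' β hbij).1 hinj

open Finset in
/-- The common kernel of the matrices `F_l (τ x y)`, where `F_l` are the Lagrange basis
polynomials of the nodes `β`, has dimension at least `|X| - 1 - K (s - 1)`. -/
theorem exists_submodule_basis_eval_eq_zero (hs : 2 ≤ s) (hinj : Function.Injective β)
    (K : ℕ) (hK : Module.rank ℝ (zonalPolynomialSpace τ (s - 1)) = K) :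
    ∃ W : Submodule ℝ (EuclideanSpace ℝ X), X.card ≤ Module.finrank ℝ W + (1 + K * (s - 1)) ∧
      ∀ w ∈ W, ∀ (l : Fin s) (z : M),
        ∑ x : X, w x * (Lagrange.basis univ β l).eval (τ z x) = 0 := by
  classical
  have hfin : Module.Finite ℝ (zonalPolynomialSpace τ (s - 1)) :=
    Module.rank_lt_aleph0_iff.1 (hK ▸ Cardinal.natCast_lt_aleph0)
  have hK' : Module.finrank ℝ (zonalPolynomialSpace τ (s - 1)) = K :=
    Module.finrank_eq_of_rank_eq hK
  have hmem (l : Fin s) (x : M) :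
      (fun z => (Lagrange.basis univ β l).eval (τ z x)) ∈ zonalPolynomialSpace τ (s - 1) := by
    refine Submodule.subset_span ⟨_, x, ?_, rfl⟩
    refine Polynomial.natDegree_le_of_degree_le ?_
    rw [Lagrange.degree_basis hinj.injOn (mem_univ l)]
    simp
  let T (l : Fin s) : EuclideanSpace ℝ X →ₗ[ℝ] zonalPolynomialSpace τ (s - 1) :=
    (Fintype.linearCombination ℝ fun x : X => (⟨_, hmem l x⟩ : zonalPolynomialSpace τ (s - 1))) ∘ₗ
      (WithLp.linearEquiv 2 ℝ (X → ℝ)).toLinearMap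
  have hT (l : Fin s) (w : EuclideanSpace ℝ X) (z : M) :
      (T l w : M → ℝ) z = ∑ x : X, w x * (Lagrange.basis univ β l).eval (τ z x) := by
    simp [T, Fintype.linearCombination_apply]
  let S : EuclideanSpace ℝ X →ₗ[ℝ] ℝ :=
    (Fintype.linearCombination ℝ fun _ : X => (1 : ℝ)) ∘ₗ
      (WithLp.linearEquiv 2 ℝ (X → ℝ)).toLinearMap
  have hS (w : EuclideanSpace ℝ X) : S w = ∑ x : X, w x := by
    simp [S, Fintype.linearCombination_apply]
  -- One index may be dropped: ∑ F_l = 1 recovers its condition from `S w = 0`, which turns K·s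
  -- conditions into 1 + K(s - 1).
  let l₀ : Fin s := ⟨0, by omega⟩
  let L := S.prod (LinearMap.pi fun l : {l : Fin s // l ≠ l₀} => T l)
  refine ⟨LinearMap.ker L, ?_, ?_⟩
  · have h1 := LinearMap.finrank_range_add_finrank_ker L
    have h2 := Submodule.finrank_le (LinearMap.range L)
    have h3 : Module.finrank ℝ (ℝ × ({l : Fin s // l ≠ l₀} → zonalPolynomialSpace τ (s - 1))) =
        1 + K * (s - 1) := by
      rw [Module.finrank_prod, Module.finrank_pi_fintype]
      simp [hK', Fintype.card_subtype_compl, mul_comm]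
    rw [h3] at h2
    simp only [finrank_euclideanSpace, Fintype.card_coe] at h1
    omega
  · intro w hw l z
    have hw' : S w = 0 ∧ ∀ l ≠ l₀, T l w = 0 := by
      have h := LinearMap.mem_ker.1 hw
      refine ⟨congrArg Prod.fst h, fun l hl => ?_⟩
      exact congrFun (congrArg Prod.snd h) ⟨l, hl⟩
    have hne (l : Fin s) (hl : l ≠ l₀) :
        ∑ x : X, w x * (Lagrange.basis univ β l).eval (τ z x) = 0 := by
      rw [← hT, hw'.2 l hl]; rfl
    by_cases hl : l = l₀
    · subst hl
      have hsum : ∑ l, ∑ x : X, w x * (Lagrange.basis univ β l).eval (τ z x) = 0 := by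
        rw [sum_comm]
        simp_rw [← mul_sum, ← Polynomial.eval_finsetSum]
        rw [Lagrange.sum_basis hinj.injOn ⟨l₀, mem_univ _⟩]
        simpa [hS] using hw'.1
      rwa [sum_eq_single l₀ (fun l _ hl => hne l hl) (by simp)] at hsum
    · exact hne l hl

open Finset in
/-- On the common kernel of the matrices `F_l (τ x y)` the matrix `P (τ x y)` is a scalar. -/
theorem sum_mul_eq_smul_of_basis_eval_eq_zero (hinj : Function.Injective β)
    (hβ : ∀ x ∈ X, ∀ y ∈ X, x ≠ y → ∃ l, τ x y = β l) {τ₀ : ℝ} (hτ₀ : ∀ x : M, τ x x = τ₀)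
    (P : ℝ → ℝ) (w : X → ℝ)
    (hw : ∀ (l : Fin s) (z : M), ∑ x : X, w x * (Lagrange.basis univ β l).eval (τ z x) = 0)
    (y : X) :
    ∑ x : X, P (τ y x) * w x = (P τ₀ + ∑ l, lagrangeWeight τ₀ β l * P (β l)) * w y := by
  classical
  have key (x : X) : P (τ y x) = ∑ l, P (β l) * (Lagrange.basis univ β l).eval (τ y x) +
      if x = y then P τ₀ + ∑ l, lagrangeWeight τ₀ β l * P (β l) else 0 := by
    split_ifs with h
    · subst h
      simp only [hτ₀, lagrangeWeight_eq_neg_eval, neg_mul, sum_neg_distrib]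
      simp only [mul_comm (P (β _))]
      ring
    · obtain ⟨m, hm⟩ := hβ y y.2 x x.2 fun h' => h (Subtype.ext h'.symm)
      rw [hm, add_zero, sum_eq_single m]
      · rw [Lagrange.eval_basis_self hinj.injOn (mem_univ m), mul_one]
      · intro l _ hl
        rw [Lagrange.eval_basis_of_ne hl (mem_univ m), mul_zero]
      · simp
  simp_rw [key, add_mul, sum_add_distrib, sum_mul]
  rw [sum_comm]
  have h0 : ∑ l, ∑ x : X, P (β l) * (Lagrange.basis univ β l).eval (τ y x) * w x = 0 := by
    refine sum_eq_zero fun l _ => ?_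
    rw [← mul_zero (P (β l)), ← hw l y, mul_sum]
    exact sum_congr rfl fun x _ => by ring
  rw [h0, zero_add]
  simp [add_mul, sum_mul]

end Distances

theorem mainTheorem6 {G M : Type*} [Group G] [TopologicalSpace G] [IsTopologicalGroup G]
    [CompactSpace G] [T2Space G] [MeasurableSpace G] [BorelSpace G]
    [MetricSpace M] [CompactSpace M] [MeasurableSpace M] [BorelSpace M] [MulAction G M]
    (hM : IsTwoPointHomogeneous G M) (x₀ : M)
    (τ : M → M → ℝ) (hτ : IsDistanceFunction τ) (τ₀ : ℝ) (hτ₀ : ∀ x : M, τ x x = τ₀)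
    (s : ℕ) (hs : 2 ≤ s) (X : Finset M) (hX : IsSDistanceSet s X)
    (β : Fin s → ℝ) (hβ : ∀ x ∈ X, ∀ y ∈ X, x ≠ y → ∃ l, τ x y = β l)
    (K : ℕ) (hK : Module.rank ℝ (zonalPolynomialSpace τ (s - 1)) = K)
    (hcard : 1 + K * (s - 1) < X.card)
    (P : ℝ → ℝ) (hP : IsNonnegZonalCombination G x₀ τ P) :
    0 ≤ ((X.card : ℝ) - 1 - K * ((s : ℝ) - 1)) *
        (P τ₀ + ∑ l, lagrangeWeight τ₀ β l * P (β l)) ∧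
    ((X.card : ℝ) - 1 - K * ((s : ℝ) - 1)) *
        (P τ₀ + ∑ l, lagrangeWeight τ₀ β l * P (β l)) ≤ X.card * P τ₀ := by
  classical
  have hinj := hX.injective hτ hβ
  obtain ⟨W, hdim, hW⟩ := exists_submodule_basis_eval_eq_zero (X := X) hs hinj K hK
  set c := P τ₀ + ∑ l, lagrangeWeight τ₀ β l * P (β l)
  let A : EuclideanSpace ℝ X →ₗ[ℝ] EuclideanSpace ℝ X :=
    Matrix.toEuclideanLin (Matrix.of fun x y : X => P (τ x y))
  have hA_apply (w : EuclideanSpace ℝ X) (y : X) : A w y = ∑ x : X, P (τ y x) * w x := by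
    simp [A, Matrix.toLpLin_apply, Matrix.mulVec, dotProduct]
  have hA_nonneg (v : EuclideanSpace ℝ X) : 0 ≤ inner ℝ v (A v) := by
    refine (hP.sum_nonneg X v).trans_eq ?_
    simp only [PiLp.inner_apply, hA_apply, RCLike.inner_apply, conj_trivial, Finset.sum_mul]
    exact Finset.sum_congr rfl fun x _ => Finset.sum_congr rfl fun y _ => by ring
  have hA_eq (w : EuclideanSpace ℝ X) (hw : w ∈ W) : A w = c • w := by
    ext y
    rw [hA_apply, sum_mul_eq_smul_of_basis_eval_eq_zero hinj hβ hτ₀ P w (hW w hw) y]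
    simp [c]
  have htrace : LinearMap.trace ℝ _ A = X.card * P τ₀ := by
    rw [LinearMap.trace_eq_sum_inner A (EuclideanSpace.basisFun X ℝ)]
    simp [EuclideanSpace.inner_single_left, hA_apply, hτ₀]
  have hle := mul_finrank_le_trace A hA_nonneg W c hA_eq
  rw [htrace] at hle
  -- The strict bound on |X| is what provides a nonzero vector of W.
  have hWpos : 0 < Module.finrank ℝ W := by omega
  have hc : 0 ≤ c := by
    have := Module.nontrivial_of_finrank_pos hWpos
    obtain ⟨⟨w, hw⟩, hw0⟩ := exists_ne (0 : W)
    have h := hA_nonneg w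
    rw [hA_eq w hw, inner_smul_right, real_inner_self_eq_norm_sq] at h
    have hpos : 0 < ‖w‖ := norm_pos_iff.2 fun h => hw0 (Subtype.ext h)
    exact nonneg_of_mul_nonneg_left h (by positivity)
  have hs1 : ((s - 1 : ℕ) : ℝ) = (s : ℝ) - 1 := by
    rw [Nat.cast_sub (by omega), Nat.cast_one]
  have hcard' : (1 : ℝ) + K * ((s : ℝ) - 1) < X.card := by
    rw [← hs1]; exact_mod_cast hcard
  have hdim' : (X.card : ℝ) ≤ Module.finrank ℝ W + (1 + K * ((s : ℝ) - 1)) := by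
    rw [← hs1]; exact_mod_cast hdim
  -- Since c ≥ 0, dim W may be replaced by its lower bound |X| - 1 - K(s - 1).
  refine ⟨mul_nonneg (by linarith) hc, le_trans ?_ hle⟩
  rw [mul_comm c]
  exact mul_le_mul_of_nonneg_right (by linarith) hc
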